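/- Let $n,m$ be positive integers, let $P\in\mathbb{R}^{n\times m}$ be a (row-)stochastic matrix, and let $\mu,\nu$ be probability measures on $[m]=\{1,\dots,m\}$ and $[n]=\{1,\dots,n\}$ respectively. For each $i\in[n]$ let $Z_i$ be a nonnegative integer and suppose that $Z_i$ samples are drawn from the law $P(i,\cdot)$ on $[m]$, all samples (within and across rows) being independent. Let $Y_{ij}$ be the number of samples of row $i$ with value $j$, and let $\widehat P(i,j)=Y_{ij}/Z_i$ be the empirical estimator of $P$. For a measure $\rho$ on a finite set put $\|f\|_{\ell^2(\rho)}=\big(\sum_x\rho(x)|f(x)|^2\big)^{1/2}$ and $\|f\|_{\ell^\infty}=\max_x|f(x)|$. For $A\in\mathbb{R}^{n\times m}$ let $$\|A\|_{\ell^2(\mu),\ell^2(\nu)}=\sup_{f\in\mathbb{R}^m,\,f\ne0}\frac{\|Af\|_{\ell^2(\nu)}}{\|f\|_{\ell^2(\mu)}}\in[0,\infty],$$ and for $B\in\mathbb{R}^{m\times n}$ let $\|B\|_{\infty,\infty}=\sup_{g\in\mathbb{R}^n,\,g\neq 0}\|Bg\|_{\ell^\infty}/\|g\|_{\ell^\infty}$.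 Let $P^\dagger\in\mathbb{R}^{m\times n}$, $P^\dagger(j,i)=\nu(i)P(i,j)/\mu(j)$, be the adjoint of $P$ with respect to $\mu$ and $\nu$. Then for all $t\ge0$ $$\mathbb{P}\Big[\|\widehat P-P\|_{\ell^2(\mu),\ell^2(\nu)}\ge t\Big]\le(n+3m)\exp\left(-\frac{t^2\,\min_{i\sim j}\frac{Z_i\,\mu(j)}{\nu(i)+\mu(j)}}{8\,\big(t+2\|P^\dagger\|_{\infty,\infty}\big)}\right),$$ where the minimum is over all pairs $(i,j)\in[n]\times[m]$ with $P(i,j)>0$. (Conventions for degenerate cases: if $\mu$ does not have full support, then in the supremum defining $\|A\|_{\ell^2(\mu),\ell^2(\nu)}$ a quotient $0/0$ is $0$ and $c/0$ is $\infty$ for $c>0$; in every other formula a quotient with denominator $0$ is read as $0$.) -/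

import Mathlib

open MeasureTheory ProbabilityTheory
open scoped ENNReal Matrix

noncomputable section

namespace StochConc

/-- The `ℓ^p(μ)` norm of a function on a finite set, for a measure given by its weights `μ`:
`(∑ x, μ x |f x|^p)^(1/p)` if `p < ∞`, and `max_x |f x|` (no measure involved) if `p = ∞`. -/
def ellNorm {ι : Type*} [Fintype ι] (p : ℝ≥0∞) (μ : ι → ℝ) (f : ι → ℝ) : ℝ :=
  if p = ∞ then ⨆ x, |f x| else (∑ x, μ x * |f x| ^ p.toReal) ^ (1 / p.toReal)

/-- The operator norm `‖A‖_{ℓ^p(μ), ℓ^q(ν)}`, the supremum over `f ≠ 0` of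
`‖A f‖_{ℓ^q(ν)} / ‖f‖_{ℓ^p(μ)}`. It is a genuine supremum in `[0, ∞]`; in the degenerate case
`‖f‖ = 0` (possible only if `μ` does not have full support) the quotient is `∞` if
`‖A f‖ ≠ 0` and `0` if `‖A f‖ = 0`. -/
def opNorm {ι κ : Type*} [Fintype ι] [Fintype κ] (p q : ℝ≥0∞) (μ : κ → ℝ) (ν : ι → ℝ)
    (A : Matrix ι κ ℝ) : ℝ≥0∞ :=
  ⨆ (f : κ → ℝ) (_ : f ≠ 0),
    ENNReal.ofReal (ellNorm q ν (A *ᵥ f)) / ENNReal.ofReal (ellNorm p μ f)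

/-- The adjoint `A†` of `A : ℓ²(μ) → ℓ²(ν)`, that is `A†(j,i) = ν(i) A(i,j) / μ(j)`. -/
def adj {ι κ : Type*} (μ : κ → ℝ) (ν : ι → ℝ) (A : Matrix ι κ ℝ) : Matrix κ ι ℝ :=
  Matrix.of fun j i => ν i * A i j / μ j

/-- The defining property of the adjoint: `⟨A f, g⟩_ν = ⟨f, A† g⟩_μ`. -/
theorem adj_spec {ι κ : Type*} [Fintype ι] [Fintype κ] (μ : κ → ℝ) (ν : ι → ℝ)
    (hμ : ∀ j, 0 < μ j) (A : Matrix ι κ ℝ) (f : κ → ℝ) (g : ι → ℝ) :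
    ∑ i, ν i * (A *ᵥ f) i * g i = ∑ j, μ j * f j * (adj μ ν A *ᵥ g) j := by
  simp only [adj, Matrix.mulVec, dotProduct, Matrix.of_apply, Finset.mul_sum, Finset.sum_mul]
  rw [Finset.sum_comm]
  refine Finset.sum_congr rfl fun j _ => Finset.sum_congr rfl fun i _ => ?_
  have := (hμ j).ne'
  field_simp

/-- The count `Y_{ij}` of the samples of row `i` that have the value `j`; the samples are
`x ⟨i, k⟩` with `k < Z i`. -/
def count {n m : ℕ} {Z : Fin n → ℕ} (x : (Σ i : Fin n, Fin (Z i)) → Fin m)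
    (i : Fin n) (j : Fin m) : ℕ :=
  (Finset.univ.filter fun k : Fin (Z i) => x ⟨i, k⟩ = j).card

/-- The empirical estimator `P̂(i,j) = Y_{ij} / Z_i`. -/
def empirical {n m : ℕ} {Z : Fin n → ℕ} (x : (Σ i : Fin n, Fin (Z i)) → Fin m) :
    Matrix (Fin n) (Fin m) ℝ :=
  Matrix.of fun i j => (count x i j : ℝ) / (Z i : ℝ)

/-- `min_{i ∼ j} Z_i μ(j) / (ν(i) + μ(j))`, over the pairs with `P(i,j) > 0`. -/
def minRatio {n m : ℕ} (P : Matrix (Fin n) (Fin m) ℝ) (Z : Fin n → ℕ) (μ : Fin m → ℝ)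
    (ν : Fin n → ℝ) : ℝ :=
  ⨅ e : {e : Fin n × Fin m // 0 < P e.1 e.2},
    (Z e.1.1 : ℝ) * μ e.1.2 / (ν e.1.1 + μ e.1.2)

end StochConc

end

namespace StochConc

open Matrix Filter Topology

/-! ### Trace inequalities and the exponential of a symmetric matrix. -/

section MatrixExponential

variable {ι : Type*} [Fintype ι]

/-! Write `r` for `minRatio` and `K` for the norm of the adjoint. With weights absorbed by `√ν` on
the left and `1/√μ` on the right, the weighted operator norm becomes a Euclidean one, and the error
`P̂ - P` becomes a sum, over all samples, of independent centred matrices with a single nonzero row.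
Passing to Hermitian dilations of size `n + m` reduces the claim to a Bernstein inequality for
symmetric matrices: if each summand has norm at most `R` and the total variance is at most `v`, the
tail is at most `(n + m) exp(-t² / (8v + 4Rt))`. Here `R = 1/r` and `v = K/r`, which is stronger
than the stated bound.

Bernstein is proved by the Laplace transform. Golden-Thompson, `tr exp(A + B) ≤ tr(exp A · exp B)`,
takes the place of Lieb's concavity theorem. Splitting off one summand at a time would ordinarily
replace the norm of the summed variances by the sum of their norms. To avoid this, each summand `C`
is compensated inside the exponent: with `V = E C²` and `C² ≤ 1/4` one has `E exp(C - 2V) ≤ 1` as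
matrices (`posSemidef_one_sub_sum_smul_exp`). Summands can then be integrated out without any loss,
and the total variance is compared with `v` only once, at the end.

Golden-Thompson itself follows from the Lie-Trotter formula and the dyadic trace inequality
`trace_mul_pow_two_pow_le`. The values of `R` and `v` come from elementary inequalities between `r`,
`Z`, `μ` and `ν`. -/

theorem trace_mul_transpose_self_nonneg (M : Matrix ι ι ℝ) : 0 ≤ (M * Mᵀ).trace := by
  simpa using (posSemidef_self_mul_conjTranspose M).trace_nonneg

theorem trace_mul_nonneg {A B : Matrix ι ι ℝ} (hA : A.PosSemidef) (hB : B.PosSemidef) :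
    0 ≤ (A * B).trace := by
  obtain ⟨m, v, rfl⟩ := Matrix.posSemidef_iff_eq_sum_vecMulVec.mp hB
  rw [Finset.mul_sum, Matrix.trace_sum]
  refine Finset.sum_nonneg fun k _ => ?_
  rw [Matrix.mul_vecMulVec, Matrix.trace_vecMulVec, dotProduct_comm]
  exact hA.dotProduct_mulVec_nonneg (v k)

theorem trace_mul_pow_comm [DecidableEq ι] (A B : Matrix ι ι ℝ) (p : ℕ) :
    ((A * B) ^ p).trace = ((B * A) ^ p).trace := by
  cases p with
  | zero => simp
  | succ p =>
    have h : SemiconjBy A ((B * A) ^ p) ((A * B) ^ p) :=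
      SemiconjBy.pow_right (by simp [SemiconjBy, mul_assoc]) p
    rw [pow_succ, pow_succ, ← mul_assoc, ← h.eq, mul_assoc, Matrix.trace_mul_comm, mul_assoc]

/-- Weighted arithmetic-geometric form of the Cauchy-Schwarz inequality for the trace. -/
theorem two_mul_trace_mul_transpose_le (M N : Matrix ι ι ℝ) :
    2 * (M * Nᵀ).trace ≤ (M * Mᵀ).trace + (N * Nᵀ).trace := by
  have h := trace_mul_transpose_self_nonneg (M - N)
  have h2 : (N * Mᵀ).trace = (M * Nᵀ).trace := by
    rw [← Matrix.trace_transpose, Matrix.transpose_mul, Matrix.transpose_transpose]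
  simp only [Matrix.transpose_sub, sub_mul, mul_sub, Matrix.trace_sub, h2] at h
  linarith

variable [DecidableEq ι]

/-- The two claims are proved together because each feeds the other. The second at level `j`,
applied to `P * Q`, gives the first at `j + 1` through the pair `P²`, `Q²`. Both at level `j`,
applied to `M²` and then to the pair `MᵀM`, `MMᵀ`, give the second at `j + 1`. -/
theorem trace_pow_two_pow_aux (j : ℕ) :
    (∀ P Q : Matrix ι ι ℝ, P.IsSymm → Q.IsSymm →
      ((P * Q) ^ 2 ^ j).trace ≤ (P ^ 2 ^ j * Q ^ 2 ^ j).trace) ∧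
    ∀ M : Matrix ι ι ℝ, (M ^ 2 ^ (j + 1)).trace ≤ ((M * Mᵀ) ^ 2 ^ j).trace := by
  induction j with
  | zero =>
    refine ⟨fun P Q _ _ => by simp, fun M => ?_⟩
    have h := two_mul_trace_mul_transpose_le M Mᵀ
    rw [Matrix.transpose_transpose, Matrix.trace_mul_comm Mᵀ M] at h
    simp only [zero_add, pow_one, pow_zero, pow_two]
    linarith
  | succ j ih =>
    obtain ⟨hmain, hpow⟩ := ih
    refine ⟨fun P Q hP hQ => ?_, fun M => ?_⟩
    · calc ((P * Q) ^ 2 ^ (j + 1)).trace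
          ≤ ((P * Q * (P * Q)ᵀ) ^ 2 ^ j).trace := hpow _
        _ = ((P ^ 2 * Q ^ 2) ^ 2 ^ j).trace := by
          rw [Matrix.transpose_mul, hP.eq, hQ.eq,
            show P * Q * (Q * P) = (P * Q ^ 2) * P by simp only [pow_two, mul_assoc],
            trace_mul_pow_comm, ← mul_assoc, ← pow_two]
        _ ≤ ((P ^ 2) ^ 2 ^ j * (Q ^ 2) ^ 2 ^ j).trace := hmain _ _ (hP.pow 2) (hQ.pow 2)
        _ = (P ^ 2 ^ (j + 1) * Q ^ 2 ^ (j + 1)).trace := by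
          rw [← pow_mul, ← pow_mul, pow_succ' 2 j]
    · have hs : ∀ N : Matrix ι ι ℝ, (Nᵀ * N).IsSymm := fun N => by
        simp [Matrix.IsSymm, Matrix.transpose_mul]
      have hs' : (M * Mᵀ).IsSymm := by simp [Matrix.IsSymm, Matrix.transpose_mul]
      -- The two squares on the right have equal traces, since powers of `MᵀM` and `MMᵀ` do; so the
      -- mixed trace is at most either of them.
      have hcs := two_mul_trace_mul_transpose_le ((Mᵀ * M) ^ 2 ^ j) ((M * Mᵀ) ^ 2 ^ j)
      rw [((hs M).pow _).eq, (hs'.pow _).eq, ← pow_add, ← pow_add, ← two_mul, ← pow_succ',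
        trace_mul_pow_comm Mᵀ M] at hcs
      calc (M ^ 2 ^ (j + 1 + 1)).trace = ((M * M) ^ 2 ^ (j + 1)).trace := by
            rw [← pow_two, ← pow_mul, ← pow_succ']
        _ ≤ ((M * M * (M * M)ᵀ) ^ 2 ^ j).trace := hpow _
        _ = (((Mᵀ * M) * (M * Mᵀ)) ^ 2 ^ j).trace := by
          rw [Matrix.transpose_mul, show M * M * (Mᵀ * Mᵀ) = (M * M * Mᵀ) * Mᵀ by
            simp only [mul_assoc], trace_mul_pow_comm]
          simp only [mul_assoc]
        _ ≤ ((Mᵀ * M) ^ 2 ^ j * (M * Mᵀ) ^ 2 ^ j).trace := hmain _ _ (hs M) hs'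
        _ ≤ ((M * Mᵀ) ^ 2 ^ (j + 1)).trace := by linarith

theorem trace_mul_pow_two_pow_le {P Q : Matrix ι ι ℝ} (hP : P.IsSymm) (hQ : Q.IsSymm) (j : ℕ) :
    ((P * Q) ^ 2 ^ j).trace ≤ (P ^ 2 ^ j * Q ^ 2 ^ j).trace :=
  (trace_pow_two_pow_aux j).1 P Q hP hQ

/-! ### The Lie-Trotter formula in a real Banach algebra. -/

section LieTrotter

variable {𝔸 : Type*} [NormedRing 𝔸] [NormOneClass 𝔸]

theorem norm_pow_sub_pow_le (x y : 𝔸) {c : ℝ} (hx : ‖x‖ ≤ c) (hy : ‖y‖ ≤ c) (hc : 1 ≤ c) (n : ℕ) :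
    ‖x ^ n - y ^ n‖ ≤ n * c ^ n * ‖x - y‖ := by
  have hc0 : 0 ≤ c := zero_le_one.trans hc
  induction n with
  | zero => simp
  | succ n ih =>
    have h : x ^ (n + 1) - y ^ (n + 1) = (x ^ n - y ^ n) * x + y ^ n * (x - y) := by
      rw [pow_succ, pow_succ]; noncomm_ring
    rw [h]
    have h1 : ‖(x ^ n - y ^ n) * x‖ ≤ n * c ^ n * ‖x - y‖ * c :=
      (norm_mul_le _ _).trans (mul_le_mul ih hx (norm_nonneg _) (by positivity))
    have h2 : ‖y ^ n * (x - y)‖ ≤ c ^ (n + 1) * ‖x - y‖ := by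
      refine (norm_mul_le _ _).trans ?_
      gcongr
      calc ‖y ^ n‖ ≤ ‖y‖ ^ n := norm_pow_le y n
        _ ≤ c ^ n := by gcongr
        _ ≤ c ^ (n + 1) := pow_le_pow_right₀ hc (Nat.le_succ n)
    calc _ ≤ _ := norm_add_le _ _
      _ ≤ n * c ^ n * ‖x - y‖ * c + c ^ (n + 1) * ‖x - y‖ := add_le_add h1 h2
      _ = _ := by push_cast; ring

theorem norm_exp_le [NormedAlgebra ℝ 𝔸] [CompleteSpace 𝔸] (x : 𝔸) :
    ‖NormedSpace.exp x‖ ≤ Real.exp ‖x‖ := by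
  rw [NormedSpace.exp_eq_tsum ℝ, Real.exp_eq_exp_ℝ]
  refine tsum_of_norm_bounded (NormedSpace.exp_series_hasSum_exp' (𝕂 := ℝ) ‖x‖) fun n => ?_
  rw [norm_smul, smul_eq_mul, Real.norm_of_nonneg (by positivity)]
  gcongr
  exact norm_pow_le x n

/-- The Lie-Trotter product formula. -/
theorem tendsto_exp_smul_mul_exp_smul_pow [NormedAlgebra ℝ 𝔸] [CompleteSpace 𝔸] (x y : 𝔸) :
    Tendsto (fun n : ℕ => (NormedSpace.exp ((n : ℝ)⁻¹ • x) * NormedSpace.exp ((n : ℝ)⁻¹ • y)) ^ n)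
      atTop (𝓝 (NormedSpace.exp (x + y))) := by
  let := NormedAlgebra.restrictScalars ℚ ℝ 𝔸
  set C := ‖x‖ + ‖y‖ with hC
  -- The two one-parameter curves agree to first order at `0`, so at parameter `1/n` they differ by
  -- `o(1/n)`; taking `n`-th powers costs only a factor `n * exp C`.
  have hd : HasDerivAt (fun t : ℝ => NormedSpace.exp (t • x) * NormedSpace.exp (t • y) -
      NormedSpace.exp (t • (x + y))) 0 0 := by
    have h := ((hasDerivAt_exp_smul_const (𝕂 := ℝ) x (0 : ℝ)).mul
      (hasDerivAt_exp_smul_const (𝕂 := ℝ) y (0 : ℝ))).sub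
      (hasDerivAt_exp_smul_const (𝕂 := ℝ) (x + y) (0 : ℝ))
    refine h.congr_deriv ?_
    simp only [zero_smul, NormedSpace.exp_zero, one_mul, mul_one, sub_self]
  have hlim : Tendsto (fun n : ℕ => (n : ℝ) * ‖NormedSpace.exp ((n : ℝ)⁻¹ • x) *
      NormedSpace.exp ((n : ℝ)⁻¹ • y) - NormedSpace.exp ((n : ℝ)⁻¹ • (x + y))‖) atTop (𝓝 0) := by
    have h := (hasDerivAt_iff_tendsto_slope_zero.1 hd).norm
    have hn : Tendsto (fun n : ℕ => (n : ℝ)⁻¹) atTop (𝓝[≠] 0) :=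
      (tendsto_inv_atTop_nhdsGT_zero.mono_right
        (nhdsWithin_mono _ fun _ h => ne_of_gt h)).comp tendsto_natCast_atTop_atTop
    have h2 := h.comp hn
    simpa [Function.comp_def, norm_smul] using h2
  rw [tendsto_iff_norm_sub_tendsto_zero]
  refine squeeze_zero' (Eventually.of_forall fun _ => norm_nonneg _) ?_
    ((mul_zero (Real.exp C)) ▸ hlim.const_mul (Real.exp C))
  filter_upwards [eventually_gt_atTop 0] with n hn
  have hn' : (n : ℝ) ≠ 0 := by positivity
  have h1 : NormedSpace.exp (x + y) = NormedSpace.exp ((n : ℝ)⁻¹ • (x + y)) ^ n := by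
    rw [← NormedSpace.exp_nsmul, ← Nat.cast_smul_eq_nsmul ℝ, smul_smul, mul_inv_cancel₀ hn',
      one_smul]
  have hns : ∀ z : 𝔸, ‖(n : ℝ)⁻¹ • z‖ = (n : ℝ)⁻¹ * ‖z‖ := fun z => by
    rw [norm_smul]; simp
  have hx : ‖NormedSpace.exp ((n : ℝ)⁻¹ • x) * NormedSpace.exp ((n : ℝ)⁻¹ • y)‖ ≤
      Real.exp ((n : ℝ)⁻¹ * C) := by
    refine (norm_mul_le _ _).trans ?_
    rw [hC, mul_add, Real.exp_add, ← hns, ← hns]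
    exact mul_le_mul (norm_exp_le _) (norm_exp_le _) (norm_nonneg _) (Real.exp_pos _).le
  have hy : ‖NormedSpace.exp ((n : ℝ)⁻¹ • (x + y))‖ ≤ Real.exp ((n : ℝ)⁻¹ * C) := by
    refine (norm_exp_le _).trans (Real.exp_le_exp.2 ?_)
    rw [hns]
    gcongr
    exact norm_add_le x y
  rw [h1]
  have hpow : Real.exp ((n : ℝ)⁻¹ * C) ^ n = Real.exp C := by
    rw [← Real.exp_nat_mul, mul_inv_cancel_left₀ hn']
  have h := norm_pow_sub_pow_le _ _ hx hy (Real.one_le_exp (by positivity)) n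
  rw [hpow] at h
  linarith

end LieTrotter

attribute [local instance] Matrix.linftyOpNormedRing Matrix.linftyOpNormedAlgebra in
/-- The Golden-Thompson inequality for real symmetric matrices. -/
theorem trace_exp_add_le {A B : Matrix ι ι ℝ} (hA : A.IsSymm) (hB : B.IsSymm) :
    (NormedSpace.exp (A + B)).trace ≤ (NormedSpace.exp A * NormedSpace.exp B).trace := by
  -- The Lie-Trotter step needs `‖1‖ = 1`, which fails for matrices of size zero.
  cases isEmpty_or_nonempty ι
  · simp [Matrix.trace]
  have h := (tendsto_exp_smul_mul_exp_smul_pow A B).comp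
    (tendsto_pow_atTop_atTop_of_one_lt (one_lt_two (α := ℕ)))
  have htr : Continuous (fun M : Matrix ι ι ℝ => M.trace) := continuous_id.matrix_trace
  refine le_of_tendsto ((htr.tendsto _).comp h) (Eventually.of_forall fun j => ?_)
  have h2 : ((2 ^ j : ℕ) : ℝ) ≠ 0 := by positivity
  have hp : ∀ M : Matrix ι ι ℝ,
      NormedSpace.exp (((2 ^ j : ℕ) : ℝ)⁻¹ • M) ^ 2 ^ j = NormedSpace.exp M := fun M => by
    rw [← Matrix.exp_nsmul, ← Nat.cast_smul_eq_nsmul ℝ, smul_smul, mul_inv_cancel₀ h2, one_smul]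
  have := trace_mul_pow_two_pow_le (P := NormedSpace.exp (((2 ^ j : ℕ) : ℝ)⁻¹ • A))
    (Q := NormedSpace.exp (((2 ^ j : ℕ) : ℝ)⁻¹ • B)) ((hA.smul _).exp) ((hB.smul _).exp) j
  rwa [hp, hp] at this

/-- A combination of `1`, `A`, `A ^ 2` and `exp A` is positive semidefinite as soon as the
corresponding scalar inequality holds on the eigenvalues of `A`. -/
theorem posSemidef_of_eigenvalues {A : Matrix ι ι ℝ} (hA : A.IsHermitian) (a b c d : ℝ)
    (h : ∀ i, 0 ≤ a + b * hA.eigenvalues i + c * hA.eigenvalues i ^ 2 +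
      d * Real.exp (hA.eigenvalues i)) :
    (a • (1 : Matrix ι ι ℝ) + b • A + c • A ^ 2 + d • NormedSpace.exp A).PosSemidef := by
  set U : Matrix ι ι ℝ := (hA.eigenvectorUnitary : Matrix ι ι ℝ)
  set D : Matrix ι ι ℝ := diagonal hA.eigenvalues with hD
  have hU1 : Uᴴ * U = 1 := Unitary.coe_star_mul_self hA.eigenvectorUnitary
  have hU2 : U * Uᴴ = 1 := Unitary.coe_mul_star_self hA.eigenvectorUnitary
  have hAU : A = U * D * Uᴴ := hA.spectral_theorem
  have hinv : U⁻¹ = Uᴴ := Matrix.inv_eq_left_inv hU1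
  have hexp : NormedSpace.exp A = U * diagonal (fun i => Real.exp (hA.eigenvalues i)) * Uᴴ := by
    conv_lhs => rw [hAU, ← hinv]
    rw [Matrix.exp_conj _ _ (IsUnit.of_mul_eq_one _ hU2), hinv, hD, Matrix.exp_diagonal]
    congr 3
    ext i
    rw [Pi.coe_exp, Real.exp_eq_exp_ℝ]
  have hsq : A ^ 2 = U * D ^ 2 * Uᴴ := by
    rw [hAU, pow_two, pow_two, show U * D * Uᴴ * (U * D * Uᴴ) = U * D * (Uᴴ * U) * D * Uᴴ by
      simp only [mul_assoc], hU1]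
    simp only [mul_assoc, one_mul]
  have key : a • (1 : Matrix ι ι ℝ) + b • A + c • A ^ 2 + d • NormedSpace.exp A =
      U * diagonal (fun i => a + b * hA.eigenvalues i + c * hA.eigenvalues i ^ 2 +
        d * Real.exp (hA.eigenvalues i)) * Uᴴ := by
    rw [hexp, hsq]
    nth_rewrite 1 [hAU]
    rw [← hU2]
    have : diagonal (fun i => a + b * hA.eigenvalues i + c * hA.eigenvalues i ^ 2 +
        d * Real.exp (hA.eigenvalues i)) = a • (1 : Matrix ι ι ℝ) + b • D + c • D ^ 2 +
        d • diagonal (fun i => Real.exp (hA.eigenvalues i)) := by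
      rw [hD, Matrix.diagonal_pow, ← Matrix.diagonal_one]
      simp only [← Matrix.diagonal_smul, Matrix.diagonal_add]
      congr 1
      ext i
      simp
    rw [this]
    simp only [mul_add, add_mul, Matrix.mul_smul, Matrix.smul_mul, mul_one]
  rw [key]
  exact (Matrix.PosSemidef.diagonal h).mul_mul_conjTranspose_same U

theorem posSemidef_exp {A : Matrix ι ι ℝ} (hA : A.IsHermitian) :
    (NormedSpace.exp A).PosSemidef := by
  simpa using posSemidef_of_eigenvalues hA 0 0 0 1 fun i => by
    simpa using (Real.exp_pos (hA.eigenvalues i)).le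

theorem exp_le_one_add_add_sq {x : ℝ} (hx : x ≤ 1) : Real.exp x ≤ 1 + x + x ^ 2 := by
  rcases le_or_gt (-1) x with h | h
  · have := abs_le.1 (Real.abs_exp_sub_one_sub_id_le (abs_le.2 ⟨h, hx⟩))
    linarith [this.2]
  · have : Real.exp x ≤ 1 := Real.exp_le_one_iff.2 (by linarith)
    nlinarith

/-- Only an upper bound on `A` is needed: the scalar inequality holds on all of `(-∞, 1]`. This lets
the compensator `-2V` be subtracted freely. -/
theorem posSemidef_one_add_add_sq_sub_exp {A : Matrix ι ι ℝ} (hA : A.IsHermitian)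
    (h1 : (1 - A).PosSemidef) : (1 + A + A ^ 2 - NormedSpace.exp A).PosSemidef := by
  have h := posSemidef_of_eigenvalues hA 1 1 1 (-1) fun i => by
    have hle : hA.eigenvalues i ≤ 1 := by
      have h2 := h1.dotProduct_mulVec_nonneg (hA.eigenvectorBasis i)
      have h3 : star (hA.eigenvectorBasis i : ι → ℝ) ⬝ᵥ (hA.eigenvectorBasis i : ι → ℝ) = 1 := by
        have := EuclideanSpace.inner_eq_star_dotProduct
          (hA.eigenvectorBasis i) (hA.eigenvectorBasis i)
        rw [dotProduct_comm, ← this, real_inner_self_eq_norm_sq,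
          hA.eigenvectorBasis.orthonormal.1 i, one_pow]
      rw [Matrix.sub_mulVec, dotProduct_sub, Matrix.one_mulVec, h3] at h2
      have h4 := hA.eigenvalues_eq i
      simp only [RCLike.re_to_real] at h4
      linarith
    linarith [exp_le_one_add_add_sq hle]
  simpa [sub_eq_add_neg] using h

/-- The trace of the exponential dominates the exponential of every Rayleigh quotient. -/
theorem exp_le_trace_exp {A : Matrix ι ι ℝ} (hA : A.IsHermitian) {z : ι → ℝ} {a : ℝ}
    (hz : z ≠ 0) (h : a * (z ⬝ᵥ z) ≤ z ⬝ᵥ A *ᵥ z) :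
    Real.exp a ≤ (NormedSpace.exp A).trace := by
  have hzz : 0 < z ⬝ᵥ z := by simpa using (dotProduct_star_self_pos_iff (v := z)).2 hz
  -- On the spectrum, `exp` lies above its tangent at `a`: `exp x ≥ exp a * (1 + x - a)`.
  have h1 := (posSemidef_of_eigenvalues hA (-(Real.exp a * (1 - a))) (-Real.exp a) 0 1 fun i => by
    have := Real.add_one_le_exp (hA.eigenvalues i - a)
    rw [Real.exp_sub, le_div_iff₀ (Real.exp_pos a)] at this
    linarith).dotProduct_mulVec_nonneg z
  simp only [zero_smul, add_zero, one_smul, Matrix.add_mulVec, Matrix.smul_mulVec,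
    Matrix.one_mulVec, dotProduct_add, dotProduct_smul, star_trivial, smul_eq_mul] at h1
  have h2 : Real.exp a * (z ⬝ᵥ z) ≤ z ⬝ᵥ NormedSpace.exp A *ᵥ z := by
    nlinarith [Real.exp_pos a]
  have h3 : z ⬝ᵥ NormedSpace.exp A *ᵥ z ≤ (z ⬝ᵥ z) * (NormedSpace.exp A).trace := by
    -- By Cauchy-Schwarz `z zᵀ ≤ (z ⬝ᵥ z) • 1`; pairing with `exp A ≥ 0` under the trace bounds the
    -- quadratic form by the trace.
    have hp : ((z ⬝ᵥ z) • (1 : Matrix ι ι ℝ) - vecMulVec z z).PosSemidef := by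
      refine Matrix.PosSemidef.of_dotProduct_mulVec_nonneg ?_ fun x => ?_
      · simp [Matrix.IsHermitian]
      · have hcs : (z ⬝ᵥ x) ^ 2 ≤ (z ⬝ᵥ z) * (x ⬝ᵥ x) := by
          simpa [dotProduct, pow_two] using
            Finset.sum_mul_sq_le_sq_mul_sq Finset.univ z x
        simp only [star_trivial, Matrix.sub_mulVec, Matrix.smul_mulVec, Matrix.one_mulVec,
          dotProduct_sub, dotProduct_smul, Matrix.vecMulVec_mulVec, smul_eq_mul,
          op_smul_eq_smul, dotProduct_comm x z]
        nlinarith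
    have h4 := trace_mul_nonneg (posSemidef_exp hA) hp
    rw [mul_sub, Matrix.mul_smul, mul_one, Matrix.mul_vecMulVec, Matrix.trace_sub,
      Matrix.trace_smul, Matrix.trace_vecMulVec, dotProduct_comm (_ *ᵥ z), smul_eq_mul] at h4
    linarith
  nlinarith

end MatrixExponential

/-! ### Bernstein's inequality for independent symmetric matrices. -/

section MatrixBernstein

variable {ι α : Type*} [Fintype α]

theorem posSemidef_sum_smul {p : α → ℝ} (hp : ∀ a, 0 ≤ p a) {M : α → Matrix ι ι ℝ}
    (hM : ∀ a, 0 < p a → (M a).PosSemidef) : (∑ a, p a • M a).PosSemidef := by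
  refine Matrix.posSemidef_sum _ fun a _ => ?_
  rcases (hp a).eq_or_lt with h | h
  · rw [← h, zero_smul]; exact Matrix.PosSemidef.zero
  · exact (hM a h).smul h.le

theorem isSymm_sum_smul (p : α → ℝ) {M : α → Matrix ι ι ℝ} (hM : ∀ a, (M a).IsSymm) :
    (∑ a, p a • M a).IsSymm := by
  simp only [Matrix.IsSymm, Matrix.transpose_sum, Matrix.transpose_smul]
  exact Finset.sum_congr rfl fun a _ => by rw [(hM a).eq]

variable [Fintype ι] [DecidableEq ι]

theorem posSemidef_sq_of_isSymm {A : Matrix ι ι ℝ} (hA : A.IsSymm) : (A ^ 2).PosSemidef := by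
  have h := posSemidef_self_mul_conjTranspose A
  rwa [conjTranspose_eq_transpose_of_trivial, hA.eq, ← pow_two] at h

/-- The difference equals `c⁻¹ • (V (c - V) V + (c - V) V (c - V))`, a sum of congruences of
positive matrices, so no spectral calculus is needed. -/
theorem posSemidef_mul_sub {V : Matrix ι ι ℝ} {c : ℝ} (hc : 0 < c) (hV : V.PosSemidef)
    (hcV : (c • 1 - V).PosSemidef) : (c • V - V ^ 2).PosSemidef := by
  have h1 := hcV.mul_mul_conjTranspose_same V
  have h2 := hV.mul_mul_conjTranspose_same (c • 1 - V)
  rw [hV.isHermitian.eq] at h1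
  rw [hcV.isHermitian.eq] at h2
  have h3 := (h1.add h2).smul (inv_nonneg.2 hc.le)
  have key : c • V - V ^ 2 =
      c⁻¹ • (V * (c • 1 - V) * V + (c • 1 - V) * V * (c • 1 - V)) := by
    have : V * (c • 1 - V) * V + (c • 1 - V) * V * (c • 1 - V) = c • (c • V - V ^ 2) := by
      simp only [mul_sub, sub_mul, smul_mul_assoc, mul_smul_comm, one_mul, mul_one, smul_sub,
        pow_two, mul_assoc]
      abel
    rw [this, smul_smul, inv_mul_cancel₀ hc.ne', one_smul]
  rwa [key]

/-- Compensating a centred bounded random symmetric matrix by twice its variance makes the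
expectation of the exponential at most the identity. -/
theorem posSemidef_one_sub_sum_smul_exp {p : α → ℝ} (hp : p ∈ stdSimplex ℝ α)
    {C : α → Matrix ι ι ℝ} (hC : ∀ a, (C a).IsSymm) (hmean : ∑ a, p a • C a = 0)
    (hbd : ∀ a, 0 < p a → ((1 / 4 : ℝ) • 1 - C a ^ 2).PosSemidef) :
    (1 - ∑ a, p a • NormedSpace.exp (C a - (2 : ℝ) • ∑ b, p b • C b ^ 2)).PosSemidef := by
  set V := ∑ b, p b • C b ^ 2 with hVdef
  obtain ⟨hp0, hp1⟩ := hp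
  have hV : V.PosSemidef := posSemidef_sum_smul hp0 fun a _ => posSemidef_sq_of_isSymm (hC a)
  have hVs : V.IsSymm := isSymm_sum_smul p fun a => (hC a).pow 2
  have hV4 : ((1 / 4 : ℝ) • 1 - V).PosSemidef := by
    have h := posSemidef_sum_smul hp0 hbd
    simp only [smul_sub, Finset.sum_sub_distrib] at h
    rwa [← Finset.sum_smul, hp1, one_smul] at h
  have hB : ∀ a, 0 < p a → (1 + (C a - (2 : ℝ) • V) + (C a - (2 : ℝ) • V) ^ 2 -
      NormedSpace.exp (C a - (2 : ℝ) • V)).PosSemidef := fun a ha => by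
    have hsymm : (C a - (2 : ℝ) • V).IsSymm := (hC a).sub (hVs.smul _)
    refine posSemidef_one_add_add_sq_sub_exp ?_ ?_
    · rwa [Matrix.IsHermitian, conjTranspose_eq_transpose_of_trivial]
    -- This rests on `1 - C + 2V = (1/2 - C)² + (1/4 - C²) + 1/2 + 2V`.
    · have h1 : ((1 / 2 : ℝ) • 1 - C a).IsSymm := (Matrix.isSymm_one.smul _).sub (hC a)
      have h2 := (((posSemidef_sq_of_isSymm h1).add (hbd a ha)).add
        (Matrix.PosSemidef.one.smul (by norm_num : (0 : ℝ) ≤ 1 / 2))).add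
        (hV.smul (zero_le_two : (0 : ℝ) ≤ 2))
      convert h2 using 1
      simp only [pow_two, mul_sub, sub_mul, smul_mul_assoc, mul_smul_comm, one_mul, mul_one,
        smul_sub, smul_smul]
      module
  have h1 := posSemidef_sum_smul hp0 hB
  -- Averaging `1 + B + B²` for `B = C - 2V` kills the terms linear in `C` and leaves `1 - V + 4V²`,
  -- which is at most `1` because `V² ≤ V/4`.
  have h2 := (posSemidef_mul_sub (by norm_num) hV hV4).smul (zero_le_four : (0 : ℝ) ≤ 4)
  have h3 := h1.add h2
  convert h3 using 1
  have hexpand : ∀ a, p a • (1 + (C a - (2 : ℝ) • V) + (C a - (2 : ℝ) • V) ^ 2 -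
      NormedSpace.exp (C a - (2 : ℝ) • V)) = p a • (1 - (2 : ℝ) • V + (4 : ℝ) • V ^ 2) + p a • C a
      + p a • C a ^ 2 - (2 : ℝ) • ((p a • C a) * V) - (2 : ℝ) • (V * (p a • C a))
      - p a • NormedSpace.exp (C a - (2 : ℝ) • V) := fun a => by
    simp only [pow_two, mul_sub, sub_mul, smul_mul_assoc, mul_smul_comm, smul_sub, smul_smul]
    module
  simp only [hexpand, Finset.sum_add_distrib, Finset.sum_sub_distrib, ← Finset.smul_sum,
    ← Finset.sum_mul, ← Finset.mul_sum, hmean, ← hVdef, ← Finset.sum_smul, hp1]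
  simp only [one_smul, zero_mul, mul_zero, smul_zero]
  module

theorem sum_mul_trace_exp_add_le {p : α → ℝ} (hp : p ∈ stdSimplex ℝ α)
    {C : α → Matrix ι ι ℝ} (hC : ∀ a, (C a).IsSymm) (hmean : ∑ a, p a • C a = 0)
    (hbd : ∀ a, 0 < p a → ((1 / 4 : ℝ) • 1 - C a ^ 2).PosSemidef)
    {H : Matrix ι ι ℝ} (hH : H.IsSymm) :
    ∑ a, p a * (NormedSpace.exp (H + (C a - (2 : ℝ) • ∑ b, p b • C b ^ 2))).trace ≤
      (NormedSpace.exp H).trace := by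
  have hVs : (∑ b, p b • C b ^ 2).IsSymm := isSymm_sum_smul p fun a => (hC a).pow 2
  have hHh : H.IsHermitian := by
    rwa [Matrix.IsHermitian, conjTranspose_eq_transpose_of_trivial]
  have h := trace_mul_nonneg (posSemidef_exp hHh)
    (posSemidef_one_sub_sum_smul_exp hp hC hmean hbd)
  rw [mul_sub, mul_one, Matrix.trace_sub, Finset.mul_sum, Matrix.trace_sum] at h
  refine le_trans (Finset.sum_le_sum fun a _ => ?_) (sub_nonneg.1 h)
  rw [Matrix.mul_smul, Matrix.trace_smul, smul_eq_mul]
  exact mul_le_mul_of_nonneg_left (trace_exp_add_le hH ((hC a).sub (hVs.smul _))) (hp.1 a)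

/-- Stating this for every symmetric `H` makes the induction work: the summand of index `0` is
frozen into `H` while the others are integrated out. -/
theorem sum_prod_mul_trace_exp_le_fin {N : ℕ} {p : Fin N → α → ℝ}
    (hp : ∀ s, p s ∈ stdSimplex ℝ α) {C : Fin N → α → Matrix ι ι ℝ}
    (hC : ∀ s a, (C s a).IsSymm) (hmean : ∀ s, ∑ a, p s a • C s a = 0)
    (hbd : ∀ s a, 0 < p s a → ((1 / 4 : ℝ) • 1 - C s a ^ 2).PosSemidef)
    {H : Matrix ι ι ℝ} (hH : H.IsSymm) :
    ∑ x : Fin N → α, (∏ s, p s (x s)) * (NormedSpace.exp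
      (H + ∑ s, (C s (x s) - (2 : ℝ) • ∑ b, p s b • C s b ^ 2))).trace ≤
      (NormedSpace.exp H).trace := by
  induction N generalizing H with
  | zero => simp
  | succ N ih =>
    refine le_trans ?_ (sum_mul_trace_exp_add_le (hp 0) (hC 0) (hmean 0) (hbd 0) hH)
    rw [← (Fin.consEquiv fun _ => α).sum_comp, Fintype.sum_prod_type]
    refine Finset.sum_le_sum fun a _ => ?_
    have hVs : (∑ b, p 0 b • C 0 b ^ 2).IsSymm := isSymm_sum_smul _ fun a => (hC 0 a).pow 2
    have h := ih (p := fun s => p s.succ) (fun s => hp _) (fun s => hC s.succ)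
      (fun s => hmean s.succ) (fun s => hbd s.succ)
      (H := H + (C 0 a - (2 : ℝ) • ∑ b, p 0 b • C 0 b ^ 2))
      (hH.add ((hC 0 a).sub (hVs.smul _)))
    refine le_trans (le_of_eq ?_) (mul_le_mul_of_nonneg_left h ((hp 0).1 a))
    rw [Finset.mul_sum]
    refine Finset.sum_congr rfl fun x _ => ?_
    simp only [Fin.consEquiv_apply, Fin.prod_univ_succ, Fin.sum_univ_succ, Fin.cons_zero,
      Fin.cons_succ, mul_assoc, add_assoc]

variable {σ : Type*} [Fintype σ] [DecidableEq σ]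

theorem sum_prod_mul_trace_exp_le {p : σ → α → ℝ}
    (hp : ∀ s, p s ∈ stdSimplex ℝ α) {C : σ → α → Matrix ι ι ℝ}
    (hC : ∀ s a, (C s a).IsSymm) (hmean : ∀ s, ∑ a, p s a • C s a = 0)
    (hbd : ∀ s a, 0 < p s a → ((1 / 4 : ℝ) • 1 - C s a ^ 2).PosSemidef) :
    ∑ x : σ → α, (∏ s, p s (x s)) * (NormedSpace.exp
      (∑ s, (C s (x s) - (2 : ℝ) • ∑ b, p s b • C s b ^ 2))).trace ≤ Fintype.card ι := by
  have e := (Fintype.equivFin σ).symm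
  have h := sum_prod_mul_trace_exp_le_fin (fun s => hp (e s)) (fun s => hC (e s))
    (fun s => hmean (e s)) (fun s => hbd (e s)) (Matrix.isSymm_zero (n := ι) (α := ℝ))
  rw [NormedSpace.exp_zero, Matrix.trace_one] at h
  refine le_trans (le_of_eq ?_) h
  rw [← (e.arrowCongr (Equiv.refl α)).sum_comp]
  refine Finset.sum_congr rfl fun x _ => ?_
  rw [← e.prod_comp, ← e.sum_comp, zero_add]
  simp

/-- A Bernstein inequality for sums of independent centred symmetric matrices, in Laplace form. -/
theorem sum_filter_prod_le_exp {p : σ → α → ℝ}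
    (hp : ∀ s, p s ∈ stdSimplex ℝ α) {C : σ → α → Matrix ι ι ℝ}
    (hC : ∀ s a, (C s a).IsSymm) (hmean : ∀ s, ∑ a, p s a • C s a = 0) {R v t θ : ℝ}
    (hbd : ∀ s a, 0 < p s a → (R ^ 2 • 1 - C s a ^ 2).PosSemidef)
    (hvar : (v • 1 - ∑ s, ∑ a, p s a • C s a ^ 2).PosSemidef)
    (hθ : 0 ≤ θ) (hR : 0 ≤ R) (hθR : θ * R ≤ 1 / 2) (E : Finset (σ → α))
    (hE : ∀ x ∈ E, (∀ s, 0 < p s (x s)) → ∀ r < t, ∃ z : ι → ℝ, z ≠ 0 ∧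
      r * (z ⬝ᵥ z) ≤ z ⬝ᵥ (∑ s, C s (x s)) *ᵥ z) :
    ∑ x ∈ E, ∏ s, p s (x s) ≤ Fintype.card ι * Real.exp (-(θ * t) + 2 * θ ^ 2 * v) := by
  set W : (σ → α) → Matrix ι ι ℝ := fun x =>
    ∑ s, (θ • C s (x s) - (2 : ℝ) • ∑ b, p s b • (θ • C s b) ^ 2) with hWdef
  have hWs : ∀ x, (W x).IsHermitian := fun x => by
    rw [Matrix.IsHermitian, conjTranspose_eq_transpose_of_trivial, hWdef, Matrix.transpose_sum]
    exact Finset.sum_congr rfl fun s _ => (((hC s _).smul _).sub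
      ((isSymm_sum_smul _ fun a => ((hC s a).smul θ).pow 2).smul _)).eq
  have hlap : ∑ x : σ → α, (∏ s, p s (x s)) * (NormedSpace.exp (W x)).trace ≤
      Fintype.card ι := by
    refine sum_prod_mul_trace_exp_le (C := fun s a => θ • C s a) hp
      (fun s a => (hC s a).smul θ) (fun s => ?_) fun s a h => ?_
    · simp only [smul_comm _ θ, ← Finset.smul_sum, hmean s, smul_zero]
    · have h1 := (hbd s a h).smul (sq_nonneg θ)
      have h2 : (0 : ℝ) ≤ 1 / 4 - (θ * R) ^ 2 := by
        have : 0 ≤ θ * R := by positivity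
        nlinarith
      convert h1.add (Matrix.PosSemidef.one.smul h2) using 1
      rw [smul_pow, smul_sub, smul_smul, mul_pow]
      module
  have hpt : ∀ x ∈ E, (∀ s, 0 < p s (x s)) →
      Real.exp (θ * t - 2 * θ ^ 2 * v) ≤ (NormedSpace.exp (W x)).trace := fun x hx hpos => by
    have hcont : Continuous fun r : ℝ => Real.exp (θ * r - 2 * θ ^ 2 * v) := by fun_prop
    -- The Rayleigh quotient is only known to exceed every `r < t`, so the bound at `t` is reached
    -- as a limit from the left.
    refine le_of_tendsto ((hcont.tendsto t).mono_left (nhdsWithin_le_nhds (s := Set.Iio t))) ?_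
    filter_upwards [self_mem_nhdsWithin] with r hr
    obtain ⟨z, hz, hzr⟩ := hE x hx hpos r hr
    refine exp_le_trace_exp (hWs x) hz ?_
    have hW : W x = θ • ∑ s, C s (x s) - (2 * θ ^ 2) • ∑ s, ∑ a, p s a • C s a ^ 2 := by
      simp only [hWdef, smul_pow, Finset.smul_sum, Finset.sum_sub_distrib, smul_smul]
      congr 1
      refine Finset.sum_congr rfl fun s _ => Finset.sum_congr rfl fun a _ => ?_
      congr 1
      ring
    have hv := hvar.dotProduct_mulVec_nonneg z
    rw [hW]
    simp only [star_trivial, Matrix.sub_mulVec, Matrix.smul_mulVec, dotProduct_sub,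
      dotProduct_smul, smul_eq_mul, Matrix.one_mulVec] at hv ⊢
    nlinarith [mul_le_mul_of_nonneg_left hzr hθ, mul_nonneg (sq_nonneg θ) hv]
  have hw : ∀ x : σ → α, 0 ≤ ∏ s, p s (x s) := fun x =>
    Finset.prod_nonneg fun s _ => (hp s).1 _
  have h1 : Real.exp (θ * t - 2 * θ ^ 2 * v) * ∑ x ∈ E, ∏ s, p s (x s) ≤ Fintype.card ι := by
    rw [Finset.mul_sum]
    calc _ ≤ ∑ x ∈ E, (∏ s, p s (x s)) * (NormedSpace.exp (W x)).trace := by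
          refine Finset.sum_le_sum fun x hx => ?_
          rw [mul_comm]
          by_cases hpos : ∀ s, 0 < p s (x s)
          · exact mul_le_mul_of_nonneg_left (hpt x hx hpos) (hw x)
          · push Not at hpos
            obtain ⟨s, hs⟩ := hpos
            rw [Finset.prod_eq_zero (Finset.mem_univ s) (le_antisymm hs ((hp s).1 _))]
            simp
      _ ≤ ∑ x : σ → α, (∏ s, p s (x s)) * (NormedSpace.exp (W x)).trace :=
          Finset.sum_le_sum_of_subset_of_nonneg (Finset.subset_univ E) fun x _ _ =>
            mul_nonneg (hw x) (posSemidef_exp (hWs x)).trace_nonneg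
      _ ≤ _ := hlap
  rw [show -(θ * t) + 2 * θ ^ 2 * v = -(θ * t - 2 * θ ^ 2 * v) by ring, Real.exp_neg,
    ← div_eq_mul_inv, le_div_iff₀ (Real.exp_pos _), mul_comm]
  exact h1

/-- A Bernstein inequality for sums of independent centred symmetric matrices. -/
theorem sum_filter_prod_le_exp_neg_div {p : σ → α → ℝ}
    (hp : ∀ s, p s ∈ stdSimplex ℝ α) {C : σ → α → Matrix ι ι ℝ}
    (hC : ∀ s a, (C s a).IsSymm) (hmean : ∀ s, ∑ a, p s a • C s a = 0) {R v t : ℝ}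
    (hbd : ∀ s a, 0 < p s a → (R ^ 2 • 1 - C s a ^ 2).PosSemidef)
    (hvar : (v • 1 - ∑ s, ∑ a, p s a • C s a ^ 2).PosSemidef)
    (hR : 0 ≤ R) (hv : 0 < v) (ht : 0 ≤ t) (E : Finset (σ → α))
    (hE : ∀ x ∈ E, (∀ s, 0 < p s (x s)) → ∀ r < t, ∃ z : ι → ℝ, z ≠ 0 ∧
      r * (z ⬝ᵥ z) ≤ z ⬝ᵥ (∑ s, C s (x s)) *ᵥ z) :
    ∑ x ∈ E, ∏ s, p s (x s) ≤ Fintype.card ι * Real.exp (-t ^ 2 / (8 * v + 4 * R * t)) := by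
  have hD : 0 < 4 * v + 2 * R * t := by positivity
  have hRt : 0 ≤ R * t := by positivity
  -- This `θ` is not the exact optimiser; it is chosen to satisfy `θ R ≤ 1/2` automatically.
  refine (sum_filter_prod_le_exp hp hC hmean hbd hvar (θ := t / (4 * v + 2 * R * t))
    (by positivity) hR ?_ E hE).trans ?_
  · rw [div_mul_eq_mul_div, div_le_iff₀ hD]
    nlinarith
  · gcongr
    have hexp : -(t / (4 * v + 2 * R * t) * t) + 2 * (t / (4 * v + 2 * R * t)) ^ 2 * v =
        -t ^ 2 * (2 * v + 2 * R * t) / (4 * v + 2 * R * t) ^ 2 := by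
      field_simp
      ring
    rw [hexp, div_le_div_iff₀ (by positivity) (by positivity)]
    nlinarith [mul_nonneg (sq_nonneg t) (mul_nonneg hRt hD.le)]

end MatrixBernstein

/-- The law of a finite family of independent finitely-valued random variables. -/
theorem measureReal_setOf_eq_sum_prod {σ α Ω : Type*} [Fintype σ] [DecidableEq σ] [Fintype α]
    [MeasurableSpace α] [MeasurableSingletonClass α] [MeasurableSpace Ω] (Pr : Measure Ω)
    [IsProbabilityMeasure Pr] {X : σ → Ω → α} (hX : ∀ s, Measurable (X s))
    (hindep : iIndepFun X Pr) (Q : (σ → α) → Prop) [DecidablePred Q] :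
    Pr.real {ω | Q fun s => X s ω} =
      ∑ x ∈ Finset.univ.filter Q, ∏ s, Pr.real {ω | X s ω = x s} := by
  have hset : {ω | Q fun s => X s ω} =
      ⋃ x ∈ Finset.univ.filter Q, ⋂ s, X s ⁻¹' {x s} := by
    ext ω
    simp only [Set.mem_ofPred_eq, Set.mem_iUnion, Set.mem_iInter, Finset.mem_filter,
      Finset.mem_univ, true_and, Set.mem_preimage, Set.mem_singleton_iff, exists_prop]
    constructor
    · exact fun h => ⟨_, h, fun s => rfl⟩
    · rintro ⟨x, hx, h⟩
      rwa [show (fun s => X s ω) = x from funext h]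
  have hmeas : ∀ x : σ → α, MeasurableSet (⋂ s, X s ⁻¹' {x s}) := fun x =>
    MeasurableSet.iInter fun s => hX s (measurableSet_singleton _)
  rw [hset, measureReal_biUnion_finset _ fun x _ => hmeas x]
  · refine Finset.sum_congr rfl fun x _ => ?_
    rw [measureReal_def, hindep.meas_iInter fun s => ⟨{x s}, measurableSet_singleton _, rfl⟩,
      ENNReal.toReal_prod]
    rfl
  · intro x _ y _ hxy
    rw [Function.onFun, Set.disjoint_left]
    intro ω hx hy
    simp only [Set.mem_iInter, Set.mem_preimage, Set.mem_singleton_iff] at hx hy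
    exact hxy (funext fun s => (hx s).symm.trans (hy s))

theorem dotProduct_self_sum {ι κ : Type*} [Fintype ι] [Fintype κ] (z : ι ⊕ κ → ℝ) :
    z ⬝ᵥ z = ∑ i, z (Sum.inl i) ^ 2 + ∑ j, z (Sum.inr j) ^ 2 := by
  simp [dotProduct, Fintype.sum_sum_type, pow_two]

/-! ### Hermitian dilations of single-row matrices. -/

section RowDilation

variable {ι κ : Type*} [DecidableEq ι]

/-- The Hermitian dilation of the matrix whose only nonzero row is the row `i`, equal to `v`. -/
def rowDilation (i : ι) (v : κ → ℝ) : Matrix (ι ⊕ κ) (ι ⊕ κ) ℝ :=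
  Matrix.fromBlocks 0 (vecMulVec (Pi.single i 1) v) (vecMulVec v (Pi.single i 1)) 0

theorem isSymm_rowDilation (i : ι) (v : κ → ℝ) : (rowDilation i v).IsSymm := by
  simp [rowDilation, Matrix.IsSymm, Matrix.fromBlocks_transpose, Matrix.transpose_vecMulVec]

theorem sum_smul_rowDilation {α : Type*} [Fintype α] (p : α → ℝ) (i : ι) (v : α → κ → ℝ)
    (h : ∀ k, ∑ a, p a * v a k = 0) : ∑ a, p a • rowDilation i (v a) = 0 := by
  ext a b
  rw [Matrix.sum_apply]
  rcases a with a | a <;> rcases b with b | b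
  · simp [rowDilation]
  · simp only [rowDilation, Matrix.smul_apply, Matrix.fromBlocks_apply₁₂, vecMulVec_apply,
      smul_eq_mul, Matrix.zero_apply]
    rw [← mul_zero ((Pi.single i 1 : ι → ℝ) a), ← h b, Finset.mul_sum]
    exact Finset.sum_congr rfl fun _ _ => by ring
  · simp only [rowDilation, Matrix.smul_apply, Matrix.fromBlocks_apply₂₁, vecMulVec_apply,
      smul_eq_mul, Matrix.zero_apply]
    rw [← mul_zero ((Pi.single i 1 : ι → ℝ) b), ← h a, Finset.mul_sum]
    exact Finset.sum_congr rfl fun _ _ => by ring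
  · simp [rowDilation]

variable [Fintype ι] [Fintype κ]

theorem rowDilation_mulVec (i : ι) (v : κ → ℝ) (z : ι ⊕ κ → ℝ) :
    rowDilation i v *ᵥ z =
      Sum.elim ((v ⬝ᵥ (z ∘ Sum.inr)) • Pi.single i 1) (z (Sum.inl i) • v) := by
  rw [rowDilation, Matrix.fromBlocks_mulVec]
  simp [Matrix.vecMulVec_mulVec]

theorem dotProduct_rowDilation_mulVec (i : ι) (v : κ → ℝ) (z : ι ⊕ κ → ℝ) :
    z ⬝ᵥ rowDilation i v *ᵥ z = 2 * (z (Sum.inl i) * (v ⬝ᵥ (z ∘ Sum.inr))) := by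
  rw [rowDilation_mulVec]
  nth_rewrite 1 [← Sum.elim_comp_inl_inr z]
  rw [sumElim_dotProduct_sumElim, dotProduct_smul, dotProduct_smul, dotProduct_single,
    dotProduct_comm _ v]
  simp only [smul_eq_mul, Function.comp_apply]
  ring

theorem dotProduct_rowDilation_sq_mulVec [DecidableEq κ] (i : ι) (v : κ → ℝ) (z : ι ⊕ κ → ℝ) :
    z ⬝ᵥ (rowDilation i v ^ 2) *ᵥ z =
      (v ⬝ᵥ (z ∘ Sum.inr)) ^ 2 + z (Sum.inl i) ^ 2 * (v ⬝ᵥ v) := by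
  have h := isSymm_rowDilation i v
  rw [pow_two, ← Matrix.mulVec_mulVec, Matrix.dotProduct_mulVec, ← Matrix.mulVec_transpose, h.eq,
    rowDilation_mulVec, sumElim_dotProduct_sumElim]
  simp only [dotProduct_smul, smul_dotProduct, smul_eq_mul, dotProduct_single, Pi.smul_apply,
    Pi.single_eq_same]
  ring

theorem posSemidef_smul_one_sub_rowDilation_sq [DecidableEq κ] (i : ι) (v : κ → ℝ) {c : ℝ}
    (hc : v ⬝ᵥ v ≤ c) : (c • 1 - rowDilation i v ^ 2).PosSemidef := by
  refine Matrix.PosSemidef.of_dotProduct_mulVec_nonneg ?_ fun z => ?_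
  · rw [Matrix.IsHermitian, conjTranspose_eq_transpose_of_trivial]
    exact ((Matrix.isSymm_one.smul c).sub ((isSymm_rowDilation i v).pow 2)).eq
  · rw [star_trivial, Matrix.sub_mulVec, dotProduct_sub, dotProduct_rowDilation_sq_mulVec,
      Matrix.smul_mulVec, Matrix.one_mulVec, dotProduct_smul, smul_eq_mul, dotProduct_self_sum]
    have hcs : (v ⬝ᵥ (z ∘ Sum.inr)) ^ 2 ≤ (v ⬝ᵥ v) * ∑ j, z (Sum.inr j) ^ 2 := by
      simpa [dotProduct, pow_two] using
        Finset.sum_mul_sq_le_sq_mul_sq Finset.univ v (z ∘ Sum.inr)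
    have hi : z (Sum.inl i) ^ 2 ≤ ∑ i, z (Sum.inl i) ^ 2 :=
      Finset.single_le_sum (f := fun i => z (Sum.inl i) ^ 2) (fun i _ => sq_nonneg _)
        (Finset.mem_univ i)
    have hy : 0 ≤ ∑ j, z (Sum.inr j) ^ 2 := Finset.sum_nonneg fun _ _ => sq_nonneg _
    have hx : 0 ≤ ∑ i, z (Sum.inl i) ^ 2 := Finset.sum_nonneg fun _ _ => sq_nonneg _
    have hv : 0 ≤ v ⬝ᵥ v := Finset.sum_nonneg fun j _ => mul_self_nonneg _
    nlinarith [mul_le_mul_of_nonneg_left hi hv, mul_le_mul_of_nonneg_right hc (add_nonneg hx hy)]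

end RowDilation

/-- The second moment about the mean is at most the second moment. -/
theorem sum_mul_sub_mean_sq_le {α : Type*} [Fintype α] {p : α → ℝ} (hp : p ∈ stdSimplex ℝ α)
    (u : α → ℝ) : ∑ a, p a * (u a - ∑ b, p b * u b) ^ 2 ≤ ∑ a, p a * u a ^ 2 := by
  set M := ∑ b, p b * u b with hM
  have h : ∑ a, p a * (u a - M) ^ 2 = ∑ a, p a * u a ^ 2 - M ^ 2 := by
    have h1 : ∀ a, p a * (u a - M) ^ 2 = p a * u a ^ 2 - 2 * M * (p a * u a) + M ^ 2 * p a :=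
      fun a => by ring
    simp only [h1, Finset.sum_add_distrib, Finset.sum_sub_distrib, ← Finset.mul_sum, ← hM, hp.2]
    ring
  rw [h]
  linarith [sq_nonneg M]

/-! ### Weighted norms and row sums of the adjoint. -/

section Adjoint

variable {ι κ : Type*} [Fintype ι] [Fintype κ]

theorem ellNorm_top (μ f : ι → ℝ) : ellNorm ∞ μ f = ⨆ x, |f x| := by simp [ellNorm]

theorem abs_le_ellNorm_top (μ f : ι → ℝ) (x : ι) : |f x| ≤ ellNorm ∞ μ f := by
  rw [ellNorm_top]
  exact le_ciSup (f := fun x => |f x|) (Set.finite_range _).bddAbove x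

theorem ellNorm_two_eq {μ : ι → ℝ} (f : ι → ℝ) :
    ellNorm 2 μ f = √(∑ x, μ x * f x ^ 2) := by
  simp [ellNorm, Real.sqrt_eq_rpow]

theorem opNorm_top_top_ne_top (μ : κ → ℝ) (ν : ι → ℝ) (A : Matrix ι κ ℝ) :
    opNorm ∞ ∞ μ ν A ≠ ∞ := by
  have hle : opNorm ∞ ∞ μ ν A ≤ ENNReal.ofReal (∑ i, ∑ j, |A i j|) := by
    refine iSup₂_le fun f hf => ?_
    refine ENNReal.div_le_of_le_mul ?_
    rw [← ENNReal.ofReal_mul (by positivity)]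
    refine ENNReal.ofReal_le_ofReal ?_
    have h0 : 0 ≤ ellNorm ∞ μ f := by
      rw [ellNorm_top]; exact Real.iSup_nonneg fun _ => abs_nonneg _
    rw [ellNorm_top]
    refine Real.iSup_le (fun i => ?_) (by positivity)
    calc |(A *ᵥ f) i| ≤ ∑ j, |A i j * f j| := Finset.abs_sum_le_sum_abs _ _
      _ ≤ ∑ j, |A i j| * ellNorm ∞ μ f := Finset.sum_le_sum fun j _ => by
          rw [abs_mul]
          exact mul_le_mul_of_nonneg_left (abs_le_ellNorm_top μ f j) (abs_nonneg _)
      _ = (∑ j, |A i j|) * ellNorm ∞ μ f := by rw [Finset.sum_mul]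
      _ ≤ _ := mul_le_mul_of_nonneg_right (Finset.single_le_sum (f := fun i => ∑ j, |A i j|)
          (fun i _ => by positivity) (Finset.mem_univ i)) h0
  exact ne_top_of_le_ne_top ENNReal.ofReal_ne_top hle

/-- Row sums are bounded by the `ℓ^∞` operator norm. -/
theorem sum_row_le_opNorm_top_top [Nonempty κ] (μ : κ → ℝ) (ν : ι → ℝ) (A : Matrix ι κ ℝ)
    (i : ι) : ∑ j, A i j ≤ (opNorm ∞ ∞ μ ν A).toReal := by
  rw [← ENNReal.ofReal_le_iff_le_toReal (opNorm_top_top_ne_top μ ν A)]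
  refine le_trans ?_ (le_iSup₂_of_le (fun _ => (1 : ℝ)) (fun h => ?_) le_rfl)
  · have h1 : ellNorm ∞ μ (fun _ : κ => (1 : ℝ)) = 1 := by simp [ellNorm_top]
    rw [h1, ENNReal.ofReal_one, div_one]
    refine ENNReal.ofReal_le_ofReal ?_
    refine le_trans (le_abs_self _) (le_trans (le_of_eq ?_) (abs_le_ellNorm_top ν _ i))
    simp [Matrix.mulVec, dotProduct]
  · exact one_ne_zero (congrFun h (Classical.arbitrary κ))

end Adjoint

/-! ### Size and variance of the sample deviations. -/

section Estimator

variable {n m : ℕ} (P : Matrix (Fin n) (Fin m) ℝ) (μ : Fin m → ℝ) (ν : Fin n → ℝ) (Z : Fin n → ℕ)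

/-- The normalised deviation from its mean of a single sample of row `i` with value `j`. -/
noncomputable def sampleDev (i : Fin n) (j : Fin m) : Fin m → ℝ := fun k =>
  √(ν i) / Z i / √(μ k) * ((if k = j then 1 else 0) - P i k)

variable {P μ ν Z}

theorem sum_mul_sampleDev (hP : ∀ i, P i ∈ stdSimplex ℝ (Fin m)) (i : Fin n) (k : Fin m) :
    ∑ j, P i j * sampleDev P μ ν Z i j k = 0 := by
  have h : ∑ j, P i j * ((if k = j then 1 else 0) - P i k) = 0 := by
    simp only [mul_sub, Finset.sum_sub_distrib, ← Finset.sum_mul, (hP i).2]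
    simp
  simp only [sampleDev, mul_left_comm (P i _), ← Finset.mul_sum, h, mul_zero]

theorem sampleDev_sq (hν : ∀ i, 0 ≤ ν i) (hμ : ∀ j, 0 ≤ μ j) (i : Fin n) (j k : Fin m) :
    sampleDev P μ ν Z i j k ^ 2 =
      ν i / Z i ^ 2 / μ k * ((if k = j then 1 else 0) - P i k) ^ 2 := by
  rw [sampleDev, mul_pow, div_pow, div_pow, Real.sq_sqrt (hν i), Real.sq_sqrt (hμ k)]

theorem minRatio_le {i : Fin n} {j : Fin m} (hij : 0 < P i j) :
    minRatio P Z μ ν ≤ Z i * μ j / (ν i + μ j) :=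
  ciInf_le (Set.finite_range _).bddBelow
    (⟨(i, j), hij⟩ : {e : Fin n × Fin m // 0 < P e.1 e.2})

theorem minRatio_nonneg (hμ : ∀ j, 0 ≤ μ j) (hν : ∀ i, 0 ≤ ν i) : 0 ≤ minRatio P Z μ ν :=
  Real.iInf_nonneg fun _ =>
    div_nonneg (mul_nonneg (Nat.cast_nonneg _) (hμ _)) (add_nonneg (hν _) (hμ _))

/-- A vanishing `μ j` or `Z i` on the support of `P` would make a ratio zero, so positivity of the
minimum removes the degenerate divisions there. -/
theorem pos_of_minRatio_pos (hμ : ∀ j, 0 ≤ μ j) (hr : 0 < minRatio P Z μ ν) {i : Fin n}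
    {j : Fin m} (hij : 0 < P i j) : 0 < μ j ∧ 0 < (Z i : ℝ) := by
  have h := hr.trans_le (minRatio_le hij)
  refine ⟨(hμ j).lt_of_ne fun h0 => ?_, (Nat.cast_nonneg _).lt_of_ne fun h0 => ?_⟩
  · simp [← h0] at h
  · simp [← h0] at h

theorem minRatio_mul_le (hμ : ∀ j, 0 ≤ μ j) (hν : ∀ i, 0 ≤ ν i) (hr : 0 < minRatio P Z μ ν)
    {i : Fin n} {j : Fin m} (hij : 0 < P i j) :
    minRatio P Z μ ν * (ν i + μ j) ≤ Z i * μ j :=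
  (le_div_iff₀ (add_pos_of_nonneg_of_pos (hν i) (pos_of_minRatio_pos hμ hr hij).1)).1
    (minRatio_le hij)

/-- Arithmetic-geometric mean: `4 ν μ ≤ (ν + μ)²`, combined with the square of `r (ν + μ) ≤ Z μ`. -/
theorem weight_le_inv_four_mul_sq (hμ : ∀ j, 0 ≤ μ j) (hν : ∀ i, 0 ≤ ν i)
    (hr : 0 < minRatio P Z μ ν) {i : Fin n} {j : Fin m} (hij : 0 < P i j) :
    ν i / Z i ^ 2 / μ j ≤ 1 / (4 * minRatio P Z μ ν ^ 2) := by
  obtain ⟨hμj, hZ⟩ := pos_of_minRatio_pos hμ hr hij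
  have h := minRatio_mul_le hμ hν hr hij
  have hs : (minRatio P Z μ ν * (ν i + μ j)) ^ 2 ≤ (Z i * μ j) ^ 2 :=
    pow_le_pow_left₀ (mul_nonneg hr.le (add_nonneg (hν i) hμj.le)) h 2
  rw [div_div, div_le_div_iff₀ (by positivity) (by positivity), one_mul]
  refine le_of_mul_le_mul_right ?_ hμj
  nlinarith [mul_nonneg (sq_nonneg (minRatio P Z μ ν)) (sq_nonneg (ν i - μ j))]

theorem weight_le_inv (hμ : ∀ j, 0 ≤ μ j) (hν : ∀ i, 0 ≤ ν i)
    (hr : 0 < minRatio P Z μ ν) {i : Fin n} {j : Fin m} (hij : 0 < P i j) :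
    ν i / Z i / μ j ≤ 1 / minRatio P Z μ ν := by
  obtain ⟨hμj, hZ⟩ := pos_of_minRatio_pos hμ hr hij
  have h := minRatio_mul_le hμ hν hr hij
  rw [div_div, div_le_div_iff₀ (by positivity) hr]
  nlinarith [mul_pos hr hμj]

theorem minRatio_le_natCast (hμ : ∀ j, 0 ≤ μ j) (hν : ∀ i, 0 ≤ ν i)
    (hr : 0 < minRatio P Z μ ν) {i : Fin n} {j : Fin m} (hij : 0 < P i j) :
    minRatio P Z μ ν ≤ Z i := by
  obtain ⟨hμj, hZ⟩ := pos_of_minRatio_pos hμ hr hij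
  have h := minRatio_mul_le hμ hν hr hij
  refine le_of_mul_le_mul_right ?_ hμj
  nlinarith [mul_nonneg hr.le (hν i)]

theorem exists_pos_of_mem_stdSimplex {α : Type*} [Fintype α] {p : α → ℝ}
    (hp : p ∈ stdSimplex ℝ α) : ∃ a, 0 < p a := by
  by_contra! h
  have := hp.2
  rw [Finset.sum_eq_zero fun a _ => le_antisymm (h a) (hp.1 a)] at this
  exact zero_ne_one this

/-- For weights `p`, a bound on the support of `p` gives a bound on the average. -/
theorem sum_mul_le_of_le_of_pos {α : Type*} [Fintype α] {p w : α → ℝ} {c : ℝ}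
    (hp : p ∈ stdSimplex ℝ α) (h : ∀ a, 0 < p a → w a ≤ c) : ∑ a, p a * w a ≤ c := by
  calc ∑ a, p a * w a ≤ ∑ a, p a * c := Finset.sum_le_sum fun a _ => by
        rcases (hp.1 a).eq_or_lt with h0 | h0
        · simp [← h0]
        · exact mul_le_mul_of_nonneg_left (h a h0) h0.le
    _ = c := by rw [← Finset.sum_mul, hp.2, one_mul]

theorem sampleDev_dotProduct_self_le (hP : ∀ i, P i ∈ stdSimplex ℝ (Fin m)) (hμ : ∀ j, 0 ≤ μ j)
    (hν : ∀ i, 0 ≤ ν i) (hr : 0 < minRatio P Z μ ν) {i : Fin n} {j : Fin m} (hij : 0 < P i j) :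
    sampleDev P μ ν Z i j ⬝ᵥ sampleDev P μ ν Z i j ≤ (1 / minRatio P Z μ ν) ^ 2 := by
  have hw : ∀ k, 0 ≤ ν i / Z i ^ 2 / μ k := fun k =>
    div_nonneg (div_nonneg (hν i) (by positivity)) (hμ k)
  have h1 : sampleDev P μ ν Z i j ⬝ᵥ sampleDev P μ ν Z i j ≤
      ν i / Z i ^ 2 / μ j + ∑ k, P i k * (ν i / Z i ^ 2 / μ k) := by
    have h2 : ν i / (Z i : ℝ) ^ 2 / μ j =
        ∑ k, ν i / Z i ^ 2 / μ k * (if k = j then 1 else 0) := by simp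
    rw [h2, ← Finset.sum_add_distrib]
    refine Finset.sum_le_sum fun k _ => ?_
    rw [← pow_two, sampleDev_sq hν hμ, mul_comm (P i k), ← mul_add]
    -- As `0 ≤ P i k ≤ 1`, the squared difference of the indicator and `P i k` is at most their sum.
    refine mul_le_mul_of_nonneg_left ?_ (hw k)
    have hk0 := (hP i).1 k
    have hk1 : P i k ≤ 1 := (hP i).2 ▸
      Finset.single_le_sum (fun k _ => (hP i).1 k) (Finset.mem_univ k)
    split_ifs <;> nlinarith
  have h3 := weight_le_inv_four_mul_sq hμ hν hr hij
  have h4 := sum_mul_le_of_le_of_pos (hP i) fun k hk => weight_le_inv_four_mul_sq hμ hν hr hk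
  have h5 : (1 / minRatio P Z μ ν) ^ 2 = 4 * (1 / (4 * minRatio P Z μ ν ^ 2)) := by
    field_simp
  have h6 : 0 ≤ 1 / (4 * minRatio P Z μ ν ^ 2) := by positivity
  linarith

theorem sum_mul_sampleDev_dotProduct_sq_le (hP : ∀ i, P i ∈ stdSimplex ℝ (Fin m))
    (hμ : ∀ j, 0 ≤ μ j) (hν : ∀ i, 0 ≤ ν i) (i : Fin n) (x : Fin m → ℝ) :
    ∑ j, P i j * (sampleDev P μ ν Z i j ⬝ᵥ x) ^ 2 ≤
      ν i / Z i ^ 2 * ∑ j, P i j * (x j ^ 2 / μ j) := by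
  have h1 : ∀ j, sampleDev P μ ν Z i j ⬝ᵥ x =
      √(ν i) / Z i * (x j / √(μ j) - ∑ k, P i k * (x k / √(μ k))) := fun j => by
    have : x j / √(μ j) = ∑ k, (if k = j then 1 else 0) * (x k / √(μ k)) := by simp
    rw [this, ← Finset.sum_sub_distrib, Finset.mul_sum, dotProduct]
    exact Finset.sum_congr rfl fun k _ => by rw [sampleDev]; ring
  have h2 := sum_mul_sub_mean_sq_le (hP i) fun j => x j / √(μ j)
  simp only [h1, mul_pow, mul_left_comm (P i _), ← Finset.mul_sum]
  rw [div_pow, Real.sq_sqrt (hν i)]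
  refine mul_le_mul_of_nonneg_left (h2.trans_eq ?_) (div_nonneg (hν i) (by positivity))
  exact Finset.sum_congr rfl fun j _ => by rw [div_pow, Real.sq_sqrt (hμ j)]

theorem sum_mul_sampleDev_dotProduct_self_le (hP : ∀ i, P i ∈ stdSimplex ℝ (Fin m))
    (hμ : ∀ j, 0 ≤ μ j) (hν : ∀ i, 0 ≤ ν i) (i : Fin n) :
    ∑ j, P i j * (sampleDev P μ ν Z i j ⬝ᵥ sampleDev P μ ν Z i j) ≤
      ∑ k, P i k * (ν i / Z i ^ 2 / μ k) := by
  simp only [dotProduct, Finset.mul_sum]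
  rw [Finset.sum_comm]
  refine Finset.sum_le_sum fun k _ => ?_
  have h := sum_mul_sub_mean_sq_le (hP i) fun j => if k = j then (1 : ℝ) else 0
  simp only [mul_ite, mul_one, mul_zero, Finset.sum_ite_eq, Finset.mem_univ, if_true, ite_pow,
    one_pow, ne_eq, OfNat.ofNat_ne_zero, not_false_eq_true, zero_pow] at h
  simp only [← pow_two, sampleDev_sq hν hμ, mul_left_comm (P i _), ← Finset.mul_sum]
  rw [mul_comm (P i k)]
  exact mul_le_mul_of_nonneg_left h (div_nonneg (div_nonneg (hν i) (by positivity)) (hμ k))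

/-- The row sums of `P†` have `μ`-average `1`, so one of them is at least `1`. This lets `K / r`
also bound the variance in the `Fin n` block, which is at most `1 / r`. -/
theorem one_le_opNorm_adj (hP : ∀ i, P i ∈ stdSimplex ℝ (Fin m)) (hμ : μ ∈ stdSimplex ℝ (Fin m))
    (hν : ν ∈ stdSimplex ℝ (Fin n)) [Nonempty (Fin n)] (hr : 0 < minRatio P Z μ ν) :
    1 ≤ (opNorm ∞ ∞ ν μ (adj μ ν P)).toReal := by
  set K := (opNorm ∞ ∞ ν μ (adj μ ν P)).toReal
  calc (1 : ℝ) = ∑ i, ν i * ∑ j, P i j := by simp [(hP _).2, hν.2]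
    _ = ∑ j, μ j * ∑ i, adj μ ν P j i := by
      simp only [Finset.mul_sum]
      rw [Finset.sum_comm]
      refine Finset.sum_congr rfl fun j _ => Finset.sum_congr rfl fun i _ => ?_
      rcases ((hP i).1 j).eq_or_lt with h | h
      · simp [adj, ← h]
      · have := (pos_of_minRatio_pos hμ.1 hr h).1.ne'
        simp only [adj, Matrix.of_apply]
        field_simp
    _ ≤ K := sum_mul_le_of_le_of_pos hμ fun j _ => sum_row_le_opNorm_top_top ν μ _ j

/-- The squared dilations act separately on the two blocks. In the `Fin m` block the variance is
controlled by row sums of `P†` times `1 / Z i ≤ 1 / r`; in the `Fin n` block, by averages of `ν i /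
(Z i μ k) ≤ 1 / r`. -/
theorem posSemidef_smul_one_sub_sum_variance (hP : ∀ i, P i ∈ stdSimplex ℝ (Fin m))
    (hμ : μ ∈ stdSimplex ℝ (Fin m)) (hν : ν ∈ stdSimplex ℝ (Fin n)) [Nonempty (Fin n)]
    (hr : 0 < minRatio P Z μ ν) :
    (((opNorm ∞ ∞ ν μ (adj μ ν P)).toReal / minRatio P Z μ ν) • 1 -
      ∑ s : Σ i : Fin n, Fin (Z i), ∑ j, P s.1 j •
        rowDilation s.1 (sampleDev P μ ν Z s.1 j) ^ 2).PosSemidef := by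
  set K := (opNorm ∞ ∞ ν μ (adj μ ν P)).toReal with hK
  set r := minRatio P Z μ ν with hrdef
  have hK1 : 1 ≤ K := one_le_opNorm_adj hP hμ hν hr
  refine Matrix.PosSemidef.of_dotProduct_mulVec_nonneg ?_ fun z => ?_
  · rw [Matrix.IsHermitian, conjTranspose_eq_transpose_of_trivial, Matrix.transpose_sub,
      Matrix.transpose_smul, Matrix.transpose_one, Matrix.transpose_sum]
    congr 1
    exact Finset.sum_congr rfl fun s _ =>
      (isSymm_sum_smul _ fun j => (isSymm_rowDilation _ _).pow 2).eq
  · simp only [star_trivial, Matrix.sub_mulVec, dotProduct_sub, Matrix.smul_mulVec,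
      Matrix.one_mulVec, dotProduct_smul, smul_eq_mul, dotProduct_self_sum, Matrix.sum_mulVec,
      dotProduct_sum, dotProduct_rowDilation_sq_mulVec]
    simp only [Fintype.sum_sigma, Finset.sum_const, Finset.card_univ, Fintype.card_fin,
      nsmul_eq_mul]
    set x : Fin m → ℝ := z ∘ Sum.inr with hx
    have hrow : ∀ i, (Z i : ℝ) * ∑ j, P i j * ((sampleDev P μ ν Z i j ⬝ᵥ x) ^ 2 +
        z (Sum.inl i) ^ 2 * (sampleDev P μ ν Z i j ⬝ᵥ sampleDev P μ ν Z i j)) ≤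
        1 / r * (∑ j, x j ^ 2 * adj μ ν P j i) + K / r * z (Sum.inl i) ^ 2 := fun i => by
      obtain ⟨j₀, hj₀⟩ : ∃ j, 0 < P i j := exists_pos_of_mem_stdSimplex (hP i)
      have hZ := (pos_of_minRatio_pos hμ.1 hr hj₀).2
      have hrZ := minRatio_le_natCast hμ.1 hν.1 hr hj₀
      have h1 := sum_mul_sampleDev_dotProduct_sq_le (Z := Z) hP hμ.1 hν.1 i x
      have h2 := sum_mul_sampleDev_dotProduct_self_le (Z := Z) hP hμ.1 hν.1 i
      have h3 := sum_mul_le_of_le_of_pos (hP i) fun k hk => weight_le_inv hμ.1 hν.1 hr hk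
      have h4 : (Z i : ℝ) * (ν i / Z i ^ 2 * ∑ j, P i j * (x j ^ 2 / μ j)) =
          1 / Z i * ∑ j, x j ^ 2 * adj μ ν P j i := by
        rw [← mul_assoc, Finset.mul_sum, Finset.mul_sum]
        refine Finset.sum_congr rfl fun j _ => ?_
        simp only [adj, Matrix.of_apply]
        field_simp
      have h5 : (Z i : ℝ) * ∑ k, P i k * (ν i / Z i ^ 2 / μ k) =
          ∑ k, P i k * (ν i / Z i / μ k) := by
        rw [Finset.mul_sum]
        refine Finset.sum_congr rfl fun j _ => ?_
        field_simp
      have h6 : 0 ≤ ∑ j, x j ^ 2 * adj μ ν P j i := Finset.sum_nonneg fun j _ =>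
        mul_nonneg (sq_nonneg _) (div_nonneg (mul_nonneg (hν.1 i) ((hP i).1 j)) (hμ.1 j))
      have h7 : 1 / (Z i : ℝ) ≤ 1 / r := one_div_le_one_div_of_le hr hrZ
      have h8 : 1 / r ≤ K / r := by gcongr
      have h9 : (Z i : ℝ) * ∑ j, P i j * ((sampleDev P μ ν Z i j ⬝ᵥ x) ^ 2 +
          z (Sum.inl i) ^ 2 * (sampleDev P μ ν Z i j ⬝ᵥ sampleDev P μ ν Z i j)) =
          Z i * ∑ j, P i j * (sampleDev P μ ν Z i j ⬝ᵥ x) ^ 2 + (Z i *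
          ∑ j, P i j * (sampleDev P μ ν Z i j ⬝ᵥ sampleDev P μ ν Z i j)) * z (Sum.inl i) ^ 2 := by
        simp only [mul_add, Finset.sum_add_distrib, mul_left_comm (P i _) (z _ ^ 2),
          ← Finset.mul_sum]
        ring
      rw [h9]
      refine add_le_add ?_ (mul_le_mul_of_nonneg_right ?_ (sq_nonneg _))
      · exact (mul_le_mul_of_nonneg_left h1 hZ.le).trans
          (h4.trans_le (mul_le_mul_of_nonneg_right h7 h6))
      · exact (mul_le_mul_of_nonneg_left h2 hZ.le).trans (h5.trans_le (h3.trans h8))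
    have hcol : ∑ i, ∑ j, x j ^ 2 * adj μ ν P j i ≤ K * ∑ j, x j ^ 2 := by
      rw [Finset.sum_comm, Finset.mul_sum]
      refine Finset.sum_le_sum fun j _ => ?_
      rw [← Finset.mul_sum, mul_comm]
      exact mul_le_mul_of_nonneg_right (sum_row_le_opNorm_top_top ν μ _ j) (sq_nonneg _)
    have htot := Finset.sum_le_sum fun i (_ : i ∈ Finset.univ) => hrow i
    rw [Finset.sum_add_distrib, ← Finset.mul_sum, ← Finset.mul_sum] at htot
    have hcol' := mul_le_mul_of_nonneg_left hcol (one_div_nonneg.2 hr.le)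
    rw [sub_nonneg]
    refine htot.trans ?_
    have : 1 / r * (K * ∑ j, x j ^ 2) = K / r * ∑ j, z (Sum.inr j) ^ 2 := by
      rw [← mul_assoc, one_div_mul_eq_div]; rfl
    linarith

theorem empirical_sub_eq_sum {x : (Σ i : Fin n, Fin (Z i)) → Fin m} {i : Fin n}
    (hZ : (Z i : ℝ) ≠ 0) (j : Fin m) :
    (empirical x - P) i j = 1 / Z i * ∑ k, ((if j = x ⟨i, k⟩ then 1 else 0) - P i j) := by
  simp only [Matrix.sub_apply, empirical, Matrix.of_apply, count, Finset.sum_sub_distrib,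
    Finset.sum_const, Finset.card_univ, Fintype.card_fin, nsmul_eq_mul, Finset.sum_boole,
    eq_comm (a := j)]
  field_simp

/-- On samples charged by the law, a large operator norm of the error of the estimator produces
a vector on which the sum of the dilations has a large Rayleigh quotient. -/
theorem exists_rayleigh_of_le_opNorm (hP : ∀ i, P i ∈ stdSimplex ℝ (Fin m))
    (hμ : ∀ j, 0 ≤ μ j) (hν : ∀ i, 0 ≤ ν i) (hr : 0 < minRatio P Z μ ν)
    {x : (Σ i : Fin n, Fin (Z i)) → Fin m} (hx : ∀ s, 0 < P s.1 (x s)) {t : ℝ} (ht : 0 < t)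
    (hop : ENNReal.ofReal t ≤ opNorm 2 2 μ ν (empirical x - P)) {c : ℝ} (hc : c < t) :
    ∃ z : Fin n ⊕ Fin m → ℝ, z ≠ 0 ∧ c * (z ⬝ᵥ z) ≤
      z ⬝ᵥ (∑ s, rowDilation s.1 (sampleDev P μ ν Z s.1 (x s))) *ᵥ z := by
  -- Truncating `c` at `0` lets the real inequality be recovered from its image in `ℝ≥0∞`.
  have hlt : ENNReal.ofReal (max c 0) < opNorm 2 2 μ ν (empirical x - P) :=
    ((ENNReal.ofReal_lt_ofReal_iff ht).2 (max_lt hc ht)).trans_le hop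
  obtain ⟨f, hlt⟩ := lt_iSup_iff.1 hlt
  obtain ⟨hf, hlt⟩ := lt_iSup_iff.1 hlt
  have hlt := ENNReal.mul_lt_of_lt_div hlt
  rw [← ENNReal.ofReal_mul (le_max_right _ _)] at hlt
  have hlt := (ENNReal.ofReal_lt_ofReal_iff'.1 hlt).1
  set X : Fin m → ℝ := fun j => √(μ j) * f j with hX
  set Y : Fin n → ℝ := fun i => √(ν i) * ((empirical x - P) *ᵥ f) i with hY
  have hXX : ∑ j, μ j * f j ^ 2 = ∑ j, X j ^ 2 :=
    Finset.sum_congr rfl fun j _ => by rw [hX, mul_pow, Real.sq_sqrt (hμ j)]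
  have hYY : ∑ i, ν i * ((empirical x - P) *ᵥ f) i ^ 2 = ∑ i, Y i ^ 2 :=
    Finset.sum_congr rfl fun i _ => by rw [hY, mul_pow, Real.sq_sqrt (hν i)]
  rw [ellNorm_two_eq, ellNorm_two_eq, hXX, hYY] at hlt
  set a := √(∑ j, X j ^ 2) with ha
  set b := √(∑ i, Y i ^ 2) with hb
  have ha2 : a ^ 2 = ∑ j, X j ^ 2 := Real.sq_sqrt (Finset.sum_nonneg fun _ _ => sq_nonneg _)
  have hb2 : b ^ 2 = ∑ i, Y i ^ 2 := Real.sq_sqrt (Finset.sum_nonneg fun _ _ => sq_nonneg _)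
  -- Where `μ j = 0`, positivity of `minRatio` forces `P i j = 0`, and `j` is not sampled because
  -- `x` is charged by the law; both sides then vanish.
  have hterm : ∀ i k j, sampleDev P μ ν Z i (x ⟨i, k⟩) j * X j =
      √(ν i) * (1 / Z i * ((if j = x ⟨i, k⟩ then 1 else 0) - P i j) * f j) := fun i k j => by
    rcases (hμ j).eq_or_lt with h | h
    · have hPj : P i j = 0 := by
        by_contra h0
        exact (pos_of_minRatio_pos hμ hr (((hP i).1 j).lt_of_ne' h0)).1.ne h
      have hj : j ≠ x ⟨i, k⟩ := fun h0 => (hx ⟨i, k⟩).ne' (h0 ▸ hPj)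
      simp [sampleDev, hPj, hj]
    · have : √(μ j) ≠ 0 := (Real.sqrt_pos.2 h).ne'
      simp only [sampleDev, hX]
      field_simp
  have hYdev : ∀ i, Y i = ∑ k, sampleDev P μ ν Z i (x ⟨i, k⟩) ⬝ᵥ X := fun i => by
    have hZ : (Z i : ℝ) ≠ 0 := by
      obtain ⟨j, hj⟩ : ∃ j, 0 < P i j := exists_pos_of_mem_stdSimplex (hP i)
      exact (pos_of_minRatio_pos hμ hr hj).2.ne'
    simp only [hY, dotProduct, Matrix.mulVec, hterm, empirical_sub_eq_sum hZ]
    rw [Finset.sum_comm, Finset.mul_sum]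
    refine Finset.sum_congr rfl fun j _ => ?_
    rw [← Finset.mul_sum, ← Finset.sum_mul, ← Finset.mul_sum]
  have ha0 : 0 ≤ a := Real.sqrt_nonneg _
  have hb0 : 0 < b := (mul_nonneg (le_max_right c 0) ha0).trans_lt hlt
  -- This excludes an infinite quotient: `Y` is linear in `X`, so `X = 0` would give `b = 0`.
  have ha0 : 0 < a := by
    refine ha0.lt_of_ne fun h => hb0.ne' ?_
    have hX0 : X = 0 := by
      have h0 : ∑ j, X j ^ 2 = 0 := by rw [← ha2, ← h]; norm_num
      ext j
      exact pow_eq_zero_iff two_ne_zero |>.1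
        ((Finset.sum_eq_zero_iff_of_nonneg fun _ _ => sq_nonneg _).1 h0 j (Finset.mem_univ j))
    simp [hb, hYdev, hX0]
  -- The factors `a = ‖X‖` and `b = ‖Y‖` give both halves the same length `a b`, so the Rayleigh
  -- quotient is exactly `b / a`.
  have hzz : Sum.elim (a • Y) (b • X) ⬝ᵥ Sum.elim (a • Y) (b • X) = 2 * (a ^ 2 * b ^ 2) := by
    rw [dotProduct_self_sum]
    simp only [Sum.elim_inl, Sum.elim_inr, Pi.smul_apply, smul_eq_mul, mul_pow,
      ← Finset.mul_sum, ← ha2, ← hb2]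
    ring
  refine ⟨Sum.elim (a • Y) (b • X), fun h0 => ?_, ?_⟩
  · rw [h0, zero_dotProduct] at hzz
    have : 0 < 2 * (a ^ 2 * b ^ 2) := by positivity
    exact this.ne hzz
  · have hS : Sum.elim (a • Y) (b • X) ⬝ᵥ
        (∑ s, rowDilation s.1 (sampleDev P μ ν Z s.1 (x s))) *ᵥ Sum.elim (a • Y) (b • X) =
        2 * (a * b * b ^ 2) := by
      rw [Matrix.sum_mulVec, dotProduct_sum, Fintype.sum_sigma]
      simp only [dotProduct_rowDilation_mulVec, Sum.elim_inl, Sum.elim_comp_inr, dotProduct_smul,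
        Pi.smul_apply, smul_eq_mul, ← Finset.mul_sum, ← hYdev]
      rw [hb2]
      simp only [Finset.mul_sum]
      exact Finset.sum_congr rfl fun i _ => by ring
    rw [hzz, hS]
    have h1 : c * a ≤ b := (mul_le_mul_of_nonneg_right (le_max_left c 0) ha0.le).trans hlt.le
    have h2 : 0 ≤ 2 * (a * b ^ 2) := by positivity
    nlinarith [mul_le_mul_of_nonneg_right h1 h2]

end Estimator

end StochConc

/-! ### The concentration inequality. -/

theorem mainTheorem9 {n m : ℕ}
    (P : Matrix (Fin n) (Fin m) ℝ) (hP : ∀ i, P i ∈ stdSimplex ℝ (Fin m))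
    (μ : Fin m → ℝ) (hμ : μ ∈ stdSimplex ℝ (Fin m))
    (ν : Fin n → ℝ) (hν : ν ∈ stdSimplex ℝ (Fin n))
    (Z : Fin n → ℕ)
    {Ω : Type*} [MeasurableSpace Ω] (Pr : Measure Ω) [IsProbabilityMeasure Pr]
    (X : (Σ i : Fin n, Fin (Z i)) → Ω → Fin m)
    (hX : ∀ s, Measurable (X s)) (hindep : iIndepFun X Pr)
    (hlaw : ∀ s j, Pr.real {ω | X s ω = j} = P s.1 j)
    (t : ℝ) (ht : 0 ≤ t) :
    Pr.real {ω | ENNReal.ofReal t ≤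
        StochConc.opNorm 2 2 μ ν (StochConc.empirical (fun s => X s ω) - P)} ≤
      ((n : ℝ) + 3 * (m : ℝ)) *
        Real.exp (-(t ^ 2 * StochConc.minRatio P Z μ ν) /
          (8 * (t + 2 * (StochConc.opNorm ∞ ∞ ν μ (StochConc.adj μ ν P)).toReal))) := by
  classical
  obtain ⟨i₀, hi₀⟩ := StochConc.exists_pos_of_mem_stdSimplex hν
  have : Nonempty (Fin n) := ⟨i₀⟩
  have hn : (1 : ℝ) ≤ n := by exact_mod_cast Fin.pos i₀
  have hm : (0 : ℝ) ≤ m := Nat.cast_nonneg m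
  set K := (StochConc.opNorm ∞ ∞ ν μ (StochConc.adj μ ν P)).toReal with hK
  set r := StochConc.minRatio P Z μ ν with hrdef
  -- Here the exponential is `1` and the prefactor at least `1`, since `n ≥ 1`. All degenerate
  -- ratios on the support of `P` end in this case.
  by_cases htriv : t = 0 ∨ r = 0
  · have hexp : -(t ^ 2 * r) / (8 * (t + 2 * K)) = 0 := by
      rcases htriv with h | h <;> simp [h]
    rw [hexp, Real.exp_zero, mul_one]
    exact measureReal_le_one.trans (by linarith)
  push Not at htriv
  have ht : 0 < t := ht.lt_of_ne' htriv.1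
  have hr : 0 < r := (StochConc.minRatio_nonneg hμ.1 hν.1).lt_of_ne' htriv.2
  have hK1 : 1 ≤ K := StochConc.one_le_opNorm_adj hP hμ hν hr
  rw [StochConc.measureReal_setOf_eq_sum_prod Pr hX hindep fun x =>
    ENNReal.ofReal t ≤ StochConc.opNorm 2 2 μ ν (StochConc.empirical x - P)]
  simp only [hlaw]
  have hbern := StochConc.sum_filter_prod_le_exp_neg_div
    (p := fun s : Σ i : Fin n, Fin (Z i) => P s.1)
    (C := fun s j => StochConc.rowDilation s.1 (StochConc.sampleDev P μ ν Z s.1 j))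
    (R := 1 / r) (v := K / r) (t := t) (fun s => hP s.1)
    (fun s j => StochConc.isSymm_rowDilation _ _)
    (fun s => StochConc.sum_smul_rowDilation _ _ _ fun k =>
      StochConc.sum_mul_sampleDev hP s.1 k)
    (fun s j hj => StochConc.posSemidef_smul_one_sub_rowDilation_sq _ _
      (StochConc.sampleDev_dotProduct_self_le hP hμ.1 hν.1 hr hj))
    (StochConc.posSemidef_smul_one_sub_sum_variance hP hμ hν hr)
    (by positivity) (by positivity) ht.le
    (Finset.univ.filter fun x =>
      ENNReal.ofReal t ≤ StochConc.opNorm 2 2 μ ν (StochConc.empirical x - P))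
    (fun x hx hpos c hc => StochConc.exists_rayleigh_of_le_opNorm hP hμ.1 hν.1 hr hpos ht
      (Finset.mem_filter.1 hx).2 hc)
  refine hbern.trans (mul_le_mul ?_ (Real.exp_le_exp.2 ?_) (Real.exp_pos _).le (by positivity))
  · rw [Fintype.card_sum, Fintype.card_fin, Fintype.card_fin]
    push_cast
    linarith
  · have h1 : -t ^ 2 / (8 * (K / r) + 4 * (1 / r) * t) = -(t ^ 2 * r) / (8 * K + 4 * t) := by
      field_simp
    rw [h1, neg_div, neg_div]
    -- Bernstein gives the denominator `8K + 4t`, smaller than the required `8t + 16K`.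
    exact neg_le_neg (div_le_div_of_nonneg_left (by positivity) (by positivity) (by linarith))
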